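/- Let $n\in\mathbb N$, let $[a,b]\subseteq\mathbb R$ with $a\le b$, let $\mathcal J=\begin{pmatrix}0&I\\-I&0\end{pmatrix}\in\mathbb R^{2n\times 2n}$ and $E=\begin{pmatrix}0\\I\end{pmatrix}\in\mathbb R^{2n\times n}$. A continuous Lagrangian path on $[a,b]$ is a continuous $Y=\begin{pmatrix}X\\U\end{pmatrix}:[a,b]\to\mathbb R^{2n\times n}$ (with $n\times n$ blocks $X$, $U$) such that $Y(t)^T\mathcal J\,Y(t)=0$ and $\operatorname{rank}Y(t)=n$ for all $t\in[a,b]$. For constant matrices $Y=\begin{pmatrix}X\\U\end{pmatrix}$, $\hat Y=\begin{pmatrix}\hat X\\\hat U\end{pmatrix}$ in $\mathbb R^{2n\times n}$ with these two properties put $W(Y,\hat Y)=Y^T\mathcal J\hat Y$, $\mathcal M=(I-X^\dagger X)\,W(Y,\hat Y)$, $V=I-\mathcal M^\dagger\mathcal M$, $\mathcal P=V\,W(Y,\hat Y)^TX^\dagger\hat X\,V$, where $\dagger$ is the Moore--Penrose pseudoinverse. The comparative index and the dual comparative index are $$\mu(Y,\hat Y)=\operatorname{rank}\mathcal M+\operatorname{ind}\mathcal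 P,\qquad \mu^*(Y,\hat Y)=\operatorname{rank}\mathcal M+\operatorname{ind}(-\mathcal P),$$ where $\operatorname{ind}$ is the number of negative eigenvalues, counted with multiplicity. For a continuous Lagrangian path $Y$ on $[a,b]$, an admissible pair $(D,R)$ consists of a finite partition $D=\{a=t_0<t_1<\dots<t_p=b\}$ and of functions $R_0,\dots,R_{p-1}$ on $[a,b]$ whose values are real symplectic $2n\times2n$ matrices, such that, for every $k$, $R_k$ is continuous on $[t_k,t_{k+1}]$ and $\operatorname{rank}W(R_k(t)E,Y(t))$ and $\operatorname{rank}\big((I\ \ 0)R_k(t)E\big)$ are constant on $[t_k,t_{k+1}]$. Put $$\mathcal N(Y,D,R)=\sum_{k=0}^{p-1}\Big(\mu\big(Y(t_{k+1}),R_k(t_{k+1})E\big)-\mu\big(Y(t_k),R_k(t_k)E\big)\Big),$$ $$\mathcal N^*(Y,D,R)=\sum_{k=0}^{p-1}\Big(\mu^*\big(Y(t_k),R_k(t_k)E\big)-\mu^*\big(Y(t_{k+1}),R_k(t_{k+1})E\big)\Big).$$ Theorem. Let $Y=\begin{pmatrix}X\\U\end{pmatrix}$ be a continuous Lagrangian path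 on $[a,b]$. Then admissible pairs $(D,R)$ exist, and $\mathcal N(Y,D,R)$ and $\mathcal N^*(Y,D,R)$ do not depend on the choice of the admissible pair. Their values, the oscillation number $\mathcal N(Y)$ and the dual oscillation number $\mathcal N^*(Y)$ of $Y$ on $[a,b]$, satisfy $$\mathcal N(Y)+\operatorname{rank}X(b)=\mathcal N^*(Y)+\operatorname{rank}X(a).$$ -/

import Mathlib

namespace LagrangianPath

open Matrix Set

/-! ### Moore--Penrose pseudoinverse of a real matrix -/

/-- The four Penrose equations: `B` is the Moore--Penrose pseudoinverse of `A`. -/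
structure IsMoorePenrose {l m : Type*} [Fintype l] [Fintype m]
    (A : Matrix l m ℝ) (B : Matrix m l ℝ) : Prop where
  mul_mul_left : A * B * A = A
  mul_mul_right : B * A * B = B
  symm_left : (A * B)ᵀ = A * B
  symm_right : (B * A)ᵀ = B * A

theorem IsMoorePenrose.unique {l m : Type*} [Fintype l] [Fintype m]
    {A : Matrix l m ℝ} {B C : Matrix m l ℝ}
    (hB : IsMoorePenrose A B) (hC : IsMoorePenrose A C) : B = C := by
  have h1 : A * B = A * C := by
    calc A * B = (A * B)ᵀ := hB.symm_left.symm
      _ = ((A * C) * (A * B))ᵀ := by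
          rw [← Matrix.mul_assoc (A * C), hC.mul_mul_left]
      _ = (A * B)ᵀ * (A * C)ᵀ := Matrix.transpose_mul _ _
      _ = (A * B) * (A * C) := by rw [hB.symm_left, hC.symm_left]
      _ = A * C := by rw [← Matrix.mul_assoc (A * B), hB.mul_mul_left]
  have h2 : B * A = C * A := by
    calc B * A = (B * A)ᵀ := hB.symm_right.symm
      _ = ((B * A) * (C * A))ᵀ := by
          rw [Matrix.mul_assoc B, ← Matrix.mul_assoc A, hC.mul_mul_left]
      _ = (C * A)ᵀ * (B * A)ᵀ := Matrix.transpose_mul _ _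
      _ = (C * A) * (B * A) := by rw [hB.symm_right, hC.symm_right]
      _ = C * A := by rw [Matrix.mul_assoc C, ← Matrix.mul_assoc A, hB.mul_mul_left]
  calc B = B * A * B := hB.mul_mul_right.symm
    _ = C * A * C := by rw [h2, Matrix.mul_assoc, h1, ← Matrix.mul_assoc]
    _ = C := hC.mul_mul_right

theorem exists_isMoorePenrose {l m : Type*} [Fintype l] [Fintype m]
    (A : Matrix l m ℝ) : ∃ B : Matrix m l ℝ, IsMoorePenrose A B := by
  classical
  have hH : (Aᵀ * A).IsHermitian := by
    simp [Matrix.IsHermitian, Matrix.conjTranspose_eq_transpose_of_trivial,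
      Matrix.transpose_mul]
  obtain ⟨G, hGs, hHs, h1, h2⟩ : ∃ G : Matrix m m ℝ, Gᵀ = G ∧
      (G * (Aᵀ * A))ᵀ = G * (Aᵀ * A) ∧
      (Aᵀ * A) * (G * (Aᵀ * A)) = Aᵀ * A ∧ G * (Aᵀ * A) * G = G := by
    set H := Aᵀ * A
    set U : Matrix m m ℝ := (hH.eigenvectorUnitary : Matrix m m ℝ) with hU
    have hUU : Uᵀ * U = 1 := by
      have := Unitary.coe_star_mul_self hH.eigenvectorUnitary
      simpa [Matrix.star_eq_conjTranspose,
        Matrix.conjTranspose_eq_transpose_of_trivial] using this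
    have hsp : H = U * diagonal hH.eigenvalues * Uᵀ := by
      have := hH.spectral_theorem
      rw [Unitary.conjStarAlgAut_apply] at this
      simpa [Matrix.star_eq_conjTranspose,
        Matrix.conjTranspose_eq_transpose_of_trivial, Function.comp_def] using this
    obtain ⟨d₀, hd₀⟩ : ∃ d₀ : m → ℝ, H = U * diagonal d₀ * Uᵀ := ⟨_, hsp⟩
    have key : ∀ d e : m → ℝ, (U * diagonal d * Uᵀ) * (U * diagonal e * Uᵀ)
        = U * diagonal (fun i => d i * e i) * Uᵀ := by
      intro d e
      calc (U * diagonal d * Uᵀ) * (U * diagonal e * Uᵀ)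
          = U * diagonal d * (Uᵀ * U) * diagonal e * Uᵀ := by simp only [Matrix.mul_assoc]
        _ = _ := by
          rw [hUU, Matrix.mul_one, Matrix.mul_assoc U, diagonal_mul_diagonal]
    have tr : ∀ d : m → ℝ, (U * diagonal d * Uᵀ)ᵀ = U * diagonal d * Uᵀ := by
      intro d
      simp [Matrix.transpose_mul, Matrix.mul_assoc]
    have hinv : ∀ x : ℝ, x * (x⁻¹ * x) = x := by
      intro x
      by_cases hx : x = 0
      · simp [hx]
      · field_simp
    have hinv' : ∀ x : ℝ, x⁻¹ * x * x⁻¹ = x⁻¹ := by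
      intro x
      by_cases hx : x = 0
      · simp [hx]
      · field_simp
    refine ⟨U * diagonal (fun i => (d₀ i)⁻¹) * Uᵀ, tr _, ?_, ?_, ?_⟩
    · rw [hd₀, key, tr]
    · rw [hd₀, key, key]
      simp only [hinv]
    · rw [hd₀, key, key]
      simp only [hinv']
  refine ⟨G * Aᵀ, ?_, ?_, ?_, ?_⟩
  · have h0 : (A * (G * (Aᵀ * A) - 1))ᵀ * (A * (G * (Aᵀ * A) - 1)) = 0 := by
      have : Aᵀ * A * (G * (Aᵀ * A) - 1) = 0 := by
        rw [Matrix.mul_sub, h1, Matrix.mul_one, sub_self]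
      rw [Matrix.transpose_mul, Matrix.mul_assoc, ← Matrix.mul_assoc Aᵀ, this, Matrix.mul_zero]
    rw [← Matrix.conjTranspose_eq_transpose_of_trivial,
      Matrix.conjTranspose_mul_self_eq_zero, Matrix.mul_sub, Matrix.mul_one, sub_eq_zero] at h0
    simpa only [Matrix.mul_assoc] using h0
  · calc G * Aᵀ * A * (G * Aᵀ) = G * (Aᵀ * A) * G * Aᵀ := by simp only [Matrix.mul_assoc]
      _ = G * Aᵀ := by rw [h2]
  · rw [Matrix.transpose_mul, Matrix.transpose_mul, Matrix.transpose_transpose, hGs,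
      Matrix.mul_assoc]
  · rw [Matrix.mul_assoc, hHs]

/-- The Moore--Penrose pseudoinverse `A†` of a real matrix `A`. -/
noncomputable def pinv {l m : Type*} [Fintype l] [Fintype m]
    (A : Matrix l m ℝ) : Matrix m l ℝ :=
  Classical.choose (exists_isMoorePenrose A)

theorem pinv_spec {l m : Type*} [Fintype l] [Fintype m] (A : Matrix l m ℝ) :
    IsMoorePenrose A (pinv A) :=
  Classical.choose_spec (exists_isMoorePenrose A)

/-! ### Lagrangian planes and paths -/

/-- The canonical skew-symmetric matrix `J = [0, I; -I, 0]`. -/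
def stdJ (n : ℕ) : Matrix (Fin n ⊕ Fin n) (Fin n ⊕ Fin n) ℝ :=
  fromBlocks 0 1 (-1) 0

/-- The vertical Lagrangian plane `E = [0; I]`. -/
def vert (n : ℕ) : Matrix (Fin n ⊕ Fin n) (Fin n) ℝ :=
  fromRows 0 1

/-- Real symplectic matrices: `Sᵀ J S = J`. -/
def IsSymplectic {n : ℕ} (S : Matrix (Fin n ⊕ Fin n) (Fin n ⊕ Fin n) ℝ) : Prop :=
  Sᵀ * stdJ n * S = stdJ n

/-- The Wronskian `W(Y, Z) = Yᵀ J Z`. -/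
def wronskian {n : ℕ} (Y Z : Matrix (Fin n ⊕ Fin n) (Fin n) ℝ) : Matrix (Fin n) (Fin n) ℝ :=
  Yᵀ * stdJ n * Z

/-- A real `2n × n` matrix `Y` with `Yᵀ J Y = 0` and `rank Y = n`. -/
def IsLagrangianPlane {n : ℕ} (Y : Matrix (Fin n ⊕ Fin n) (Fin n) ℝ) : Prop :=
  wronskian Y Y = 0 ∧ Y.rank = n

/-- `Y` is a continuous Lagrangian path on `[a, b]`. Only the values on `[a, b]` matter. -/
structure IsLagrangianPath {n : ℕ} (a b : ℝ)
    (Y : ℝ → Matrix (Fin n ⊕ Fin n) (Fin n) ℝ) : Prop where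
  continuousOn : ContinuousOn Y (Icc a b)
  lagrangian : ∀ t ∈ Icc a b, IsLagrangianPlane (Y t)

/-! ### Comparative index -/

/-- The number of negative eigenvalues, counted with multiplicity. -/
noncomputable def ind {n : ℕ} (P : Matrix (Fin n) (Fin n) ℝ) : ℕ :=
  (P.charpoly.roots.filter (fun x => x < 0)).card

/-- `M = (I - X† X) W(Y, Z)`, where `X` is the upper block of `Y`. -/
noncomputable def ciM {n : ℕ} (Y Z : Matrix (Fin n ⊕ Fin n) (Fin n) ℝ) :
    Matrix (Fin n) (Fin n) ℝ :=
  (1 - pinv Y.toRows₁ * Y.toRows₁) * wronskian Y Z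

/-- `V = I - M† M`. -/
noncomputable def ciV {n : ℕ} (Y Z : Matrix (Fin n ⊕ Fin n) (Fin n) ℝ) :
    Matrix (Fin n) (Fin n) ℝ :=
  1 - pinv (ciM Y Z) * ciM Y Z

/-- `P = V W(Y, Z)ᵀ X† X' V`, where `X`, `X'` are the upper blocks of `Y`, `Z`. -/
noncomputable def ciP {n : ℕ} (Y Z : Matrix (Fin n ⊕ Fin n) (Fin n) ℝ) :
    Matrix (Fin n) (Fin n) ℝ :=
  ciV Y Z * (wronskian Y Z)ᵀ * pinv Y.toRows₁ * Z.toRows₁ * ciV Y Z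

/-- The comparative index `μ(Y, Z) = rank M + ind P`. -/
noncomputable def compIndex {n : ℕ} (Y Z : Matrix (Fin n ⊕ Fin n) (Fin n) ℝ) : ℕ :=
  (ciM Y Z).rank + ind (ciP Y Z)

/-- The dual comparative index `μ*(Y, Z) = rank M + ind (-P)`. -/
noncomputable def dualCompIndex {n : ℕ} (Y Z : Matrix (Fin n ⊕ Fin n) (Fin n) ℝ) : ℕ :=
  (ciM Y Z).rank + ind (-ciP Y Z)

/-! ### Oscillation numbers -/

/-- An admissible pair `(D, R)` for the path `Y` on `[a, b]`: a partition
`a = t 0 < t 1 < ⋯ < t p = b` and symplectic matrix functions `R k`, `k = 0, …, p - 1`, with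
`R k` continuous on `[t k, t (k + 1)]`, such that on this interval the ranks of
`W(R k s E, Y s)` and of the upper block of `R k s E` do not depend on `s`.
(Up to sign, `W(R k s E, Y s)` is the upper block of `(R k s)⁻¹ Y s`.) -/
structure AdmissibleSystem {n : ℕ} (a b : ℝ)
    (Y : ℝ → Matrix (Fin n ⊕ Fin n) (Fin n) ℝ) where
  /-- the number of subintervals -/
  p : ℕ
  /-- the partition points -/
  t : Fin (p + 1) → ℝ
  strictMono : StrictMono t
  t_first : t 0 = a
  t_last : t (Fin.last p) = b
  /-- the transformation matrices -/
  R : Fin p → ℝ → Matrix (Fin n ⊕ Fin n) (Fin n ⊕ Fin n) ℝ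
  symplectic : ∀ k, ∀ s ∈ Icc a b, IsSymplectic (R k s)
  continuousOn : ∀ k, ContinuousOn (R k) (Icc (t k.castSucc) (t k.succ))
  rank_wronskian : ∀ k, ∃ r : ℕ, ∀ s ∈ Icc (t k.castSucc) (t k.succ),
    (wronskian (R k s * vert n) (Y s)).rank = r
  rank_upper : ∀ k, ∃ r : ℕ, ∀ s ∈ Icc (t k.castSucc) (t k.succ),
    (R k s * vert n).toRows₁.rank = r

/-- The sum over `k` of the increments of `μ(Y s, R k s E)` from `s = t k` to `s = t (k + 1)`. -/
noncomputable def AdmissibleSystem.osc {n : ℕ} {a b : ℝ}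
    {Y : ℝ → Matrix (Fin n ⊕ Fin n) (Fin n) ℝ} (S : AdmissibleSystem a b Y) : ℤ :=
  ∑ k : Fin S.p,
    ((compIndex (Y (S.t k.succ)) (S.R k (S.t k.succ) * vert n) : ℤ)
      - (compIndex (Y (S.t k.castSucc)) (S.R k (S.t k.castSucc) * vert n) : ℤ))

/-- The sum over `k` of the increments of `μ*(Y s, R k s E)` from `s = t (k + 1)` to `s = t k`. -/
noncomputable def AdmissibleSystem.dualOsc {n : ℕ} {a b : ℝ}
    {Y : ℝ → Matrix (Fin n ⊕ Fin n) (Fin n) ℝ} (S : AdmissibleSystem a b Y) : ℤ :=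
  ∑ k : Fin S.p,
    ((dualCompIndex (Y (S.t k.castSucc)) (S.R k (S.t k.castSucc) * vert n) : ℤ)
      - (dualCompIndex (Y (S.t k.succ)) (S.R k (S.t k.succ) * vert n) : ℤ))

open Classical in
/-- The oscillation number of `Y` on `[a, b]`: the value of `S.osc` for any admissible system `S`
(`0` if there is none). -/
noncomputable def oscNumber {n : ℕ} (a b : ℝ)
    (Y : ℝ → Matrix (Fin n ⊕ Fin n) (Fin n) ℝ) : ℤ :=
  if h : Nonempty (AdmissibleSystem a b Y) then (Classical.choice h).osc else 0

open Classical in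
/-- The dual oscillation number of `Y` on `[a, b]`: the value of `S.dualOsc` for any admissible
system `S` (`0` if there is none). -/
noncomputable def dualOscNumber {n : ℕ} (a b : ℝ)
    (Y : ℝ → Matrix (Fin n ⊕ Fin n) (Fin n) ℝ) : ℤ :=
  if h : Nonempty (AdmissibleSystem a b Y) then (Classical.choice h).dualOsc else 0

end LagrangianPath

/-! For real `s`, a Lagrangian plane `Y = [X; U]` with `U - s X` invertible is represented by the
symmetric matrix `A = X (U - s X)⁻¹`. All but finitely many `s` are usable for a given plane. If `A`
and `B` represent `Y` and `Z` in one chart, the pseudoinverse formula reduces to ordinary inertia: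
`μ(Y, Z) + ind A = ind (A - B) + ind B` (`compIndex_add_negIndex_chart`). It comes from computing
the inertia of `[A, B; B, B]` in two ways.

Here `rank (A - B) = rank W(Z, Y)` and `rank B` is the rank of the upper block of `Z`. Admissibility
keeps both constant, and a continuous symmetric matrix of constant rank has locally constant
negative index. Hence `μ(Y, R E) + ind A` is locally constant on each subinterval: locally, the
oscillation sum changes by the decrease of `ind A`, which does not involve `R`. The partial sums of
two admissible systems therefore differ by a locally constant function that vanishes at `a`
(`osc_eq`).

Adding the chart identity to its dual gives `μ + μ* + rank X = rank W + rank Z.toRows₁`. The right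
side is constant on each subinterval, so summing increments yields the final relation, and with it
the independence of the dual number. -/

namespace LagrangianPath

open Matrix Set

/-! ### Inertia of symmetric matrices -/

section Inertia

variable {m k : Type*} [Fintype m] [DecidableEq m] [Fintype k] [DecidableEq k]

/-- The number of negative roots of the characteristic polynomial, for any finite index type. -/
noncomputable def negIndex (G : Matrix m m ℝ) : ℕ :=
  (G.charpoly.roots.filter (fun x => x < 0)).card

theorem ind_eq_negIndex {n : ℕ} (P : Matrix (Fin n) (Fin n) ℝ) : ind P = negIndex P := rfl

/-- The quadratic form `x ↦ xᵀ G x`. -/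
noncomputable def quadForm (G : Matrix m m ℝ) : QuadraticForm ℝ (m → ℝ) :=
  LinearMap.BilinMap.toQuadraticMap (Matrix.toLinearMap₂' ℝ G)

theorem quadForm_apply (G : Matrix m m ℝ) (x : m → ℝ) : quadForm G x = x ⬝ᵥ G *ᵥ x := by
  simp [quadForm, Matrix.toLinearMap₂'_apply']

theorem exists_orthogonal_diagonalization {G : Matrix m m ℝ} (hG : Gᵀ = G) :
    ∃ (U : Matrix m m ℝ) (d : m → ℝ), Uᵀ * U = 1 ∧ G = U * diagonal d * Uᵀ := by
  have hH : G.IsHermitian := by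
    rwa [Matrix.IsHermitian, Matrix.conjTranspose_eq_transpose_of_trivial]
  refine ⟨hH.eigenvectorUnitary, hH.eigenvalues, ?_, ?_⟩
  · have := Unitary.coe_star_mul_self hH.eigenvectorUnitary
    simpa [Matrix.star_eq_conjTranspose,
      Matrix.conjTranspose_eq_transpose_of_trivial] using this
  · have := hH.spectral_theorem
    rw [Unitary.conjStarAlgAut_apply] at this
    simpa [Matrix.star_eq_conjTranspose,
      Matrix.conjTranspose_eq_transpose_of_trivial, Function.comp_def] using this

theorem quadForm_equivalent_of_congruence {G : Matrix m m ℝ} {T : Matrix m m ℝ}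
    (hT : IsUnit T) : (quadForm (Tᵀ * G * T)).Equivalent (quadForm G) := by
  obtain ⟨T, rfl⟩ := hT
  refine ⟨⟨Matrix.toLinearEquiv' (T : Matrix m m ℝ) inferInstance, fun x => ?_⟩⟩
  have : ∀ y, (Matrix.toLinearEquiv' (T : Matrix m m ℝ) inferInstance) y =
    (T : Matrix m m ℝ) *ᵥ y := fun y => rfl
  simp only [AddHom.toFun_eq_coe, LinearMap.coe_toAddHom, LinearEquiv.coe_coe, this,
    quadForm_apply]
  rw [← Matrix.mulVec_mulVec, ← Matrix.mulVec_mulVec, Matrix.dotProduct_mulVec x,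
    Matrix.vecMul_transpose]

theorem quadForm_diagonal (d : m → ℝ) :
    quadForm (diagonal d) = QuadraticMap.weightedSumSquares ℝ d := by
  ext x
  simp [quadForm_apply, QuadraticMap.weightedSumSquares_apply, dotProduct, mulVec_diagonal]
  exact Finset.sum_congr rfl fun i _ => by ring

theorem negIndex_diagonalized {U : Matrix m m ℝ} (hU : Uᵀ * U = 1) (d : m → ℝ) :
    negIndex (U * diagonal d * Uᵀ) = {i | d i < 0}.ncard := by
  classical
  have : (U * diagonal d * Uᵀ).charpoly.roots = Finset.univ.val.map d := by
    rw [Matrix.charpoly_mul_comm, ← Matrix.mul_assoc, hU, Matrix.one_mul, charpoly_diagonal,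
      Polynomial.roots_prod]
    · simp
    · simp [Finset.prod_ne_zero_iff, Polynomial.X_sub_C_ne_zero]
  rw [negIndex, this, Multiset.filter_map, Multiset.card_map, Set.ncard_eq_toFinset_card']
  simp [Finset.card_def, Finset.filter_val]

theorem negIndex_eq_sigNeg {G : Matrix m m ℝ} (hG : Gᵀ = G) :
    negIndex G = sigNeg (quadForm G) := by
  obtain ⟨U, d, hU, rfl⟩ := exists_orthogonal_diagonalization hG
  have hUt : IsUnit Uᵀ := IsUnit.of_mul_eq_one U hU
  rw [negIndex_diagonalized hU]
  refine (QuadraticForm.sigNeg_of_equiv_weightedSumSquares ?_).symm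
  rw [← quadForm_diagonal]
  have := quadForm_equivalent_of_congruence (G := diagonal d) hUt
  rwa [Matrix.transpose_transpose] at this

/-- Sylvester's law of inertia. -/
theorem negIndex_congruence {G : Matrix m m ℝ} (hG : Gᵀ = G) {T : Matrix m m ℝ}
    (hT : IsUnit T) : negIndex (Tᵀ * G * T) = negIndex G := by
  rw [negIndex_eq_sigNeg hG, negIndex_eq_sigNeg]
  · exact (quadForm_equivalent_of_congruence hT).sigNeg_eq
  · simp [Matrix.transpose_mul, hG, Matrix.mul_assoc]

/-- Links rank to inertia: constancy of a rank becomes constancy of a sum of two negative indices.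
-/
theorem negIndex_add_negIndex_neg {G : Matrix m m ℝ} (hG : Gᵀ = G) :
    negIndex G + negIndex (-G) = G.rank := by
  classical
  obtain ⟨U, d, hU, rfl⟩ := exists_orthogonal_diagonalization hG
  have hUt : IsUnit Uᵀ := IsUnit.of_mul_eq_one U hU
  have hU' : IsUnit U := IsUnit.of_mul_eq_one_right Uᵀ hU
  have : -(U * diagonal d * Uᵀ) = U * diagonal (fun i => -d i) * Uᵀ := by
    have : diagonal (fun i => -d i) = -diagonal d := by
      ext i j; by_cases h : i = j <;> simp [h, Matrix.diagonal]
    rw [this, Matrix.mul_neg, Matrix.neg_mul]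
  rw [this, negIndex_diagonalized hU, negIndex_diagonalized hU,
    Matrix.rank_mul_eq_left_of_isUnit_det _ _ ((Matrix.isUnit_iff_isUnit_det _).1 hUt),
    Matrix.rank_mul_eq_right_of_isUnit_det _ _ ((Matrix.isUnit_iff_isUnit_det _).1 hU'),
    Matrix.rank_diagonal, ← Nat.card_eq_fintype_card, ← Set.ncard_union_eq]
  · rw [← Nat.card_coe_set_eq]
    refine Nat.card_congr (Equiv.setCongr ?_)
    ext i
    simp only [Set.mem_union, Set.mem_ofPred_eq, Left.neg_neg_iff, lt_or_lt_iff_ne]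
    rfl
  · exact Set.disjoint_left.2 fun i hi hi' => by
      simp only [Set.mem_ofPred_eq] at hi hi'; linarith

/-- Since `G H = 0`, `(x - G)(x - H) = x (x - (G + H))`. After taking determinants, the extra power
of `x` adds only zero roots. Symmetry plays no role. -/
theorem negIndex_add_of_mul_eq_zero {G H : Matrix m m ℝ} (h : G * H = 0) :
    negIndex (G + H) = negIndex G + negIndex H := by
  have key : G.charpoly * H.charpoly = Polynomial.X ^ Fintype.card m * (G + H).charpoly := by
    have e : G.charmatrix * H.charmatrix =
        (Polynomial.X : Polynomial ℝ) • (G + H).charmatrix := by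
      simp only [charmatrix, map_add, RingHom.mapMatrix_apply]
      have h0 : G.map (Polynomial.C : ℝ →+* Polynomial ℝ) *
          H.map (Polynomial.C : ℝ →+* Polynomial ℝ) = 0 := by
        rw [← Matrix.map_mul, h]; simp
      rw [Matrix.sub_mul, Matrix.mul_sub, Matrix.mul_sub, h0, Matrix.scalar_apply,
        ← Matrix.smul_one_eq_diagonal]
      simp only [Matrix.smul_mul, Matrix.mul_smul, Matrix.one_mul, Matrix.mul_one, smul_sub,
        smul_add]
      abel
    rw [charpoly, charpoly, ← Matrix.det_mul, e, Matrix.det_smul, charpoly]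
  have hne : G.charpoly * H.charpoly ≠ 0 :=
    mul_ne_zero (charpoly_monic G).ne_zero (charpoly_monic H).ne_zero
  have hr := congrArg Polynomial.roots key
  rw [Polynomial.roots_mul hne, Polynomial.roots_mul (key ▸ hne), Polynomial.roots_X_pow] at hr
  have hc := congrArg (fun s => (s.filter (fun x : ℝ => x < 0)).card) hr
  simp only [Multiset.filter_add, Multiset.card_add, Multiset.filter_nsmul,
    Multiset.card_nsmul] at hc
  rw [(Multiset.filter_eq_nil (s := {(0 : ℝ)})).2 (by simp)] at hc
  simp only [Multiset.card_zero, mul_zero, zero_add] at hc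
  exact hc.symm

theorem negIndex_fromBlocks_diagonal (A : Matrix m m ℝ) (D : Matrix k k ℝ) :
    negIndex (fromBlocks A 0 0 D) = negIndex A + negIndex D := by
  rw [negIndex, charpoly_fromBlocks_zero₁₂, Polynomial.roots_mul, Multiset.filter_add,
    Multiset.card_add, negIndex, negIndex]
  exact mul_ne_zero (charpoly_monic _).ne_zero (charpoly_monic _).ne_zero

theorem negIndex_zero : negIndex (0 : Matrix m m ℝ) = 0 := by
  rw [negIndex, charpoly_zero, Polynomial.roots_X_pow, Multiset.card_eq_zero,
    Multiset.filter_eq_nil]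
  simp

/-! ### Local constancy -/

/-- Lower semicontinuity: the form of `G₀` is negative on the compact unit sphere of a maximal
negative definite subspace, and stays negative there under small perturbations. -/
theorem eventually_negIndex_le {T : Type*} [TopologicalSpace T] {l : Filter T}
    {G : T → Matrix m m ℝ} {G₀ : Matrix m m ℝ} (hG : Filter.Tendsto G l (nhds G₀))
    (hs : ∀ᶠ t in l, (G t)ᵀ = G t) (h₀ : G₀ᵀ = G₀) :
    ∀ᶠ t in l, negIndex G₀ ≤ negIndex (G t) := by
  obtain ⟨V, hV, hneg⟩ := exists_finrank_eq_sigNeg_and_negDef (quadForm G₀)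
  have hcont : Continuous fun p : Matrix m m ℝ × (m → ℝ) => p.2 ⬝ᵥ p.1 *ᵥ p.2 := by fun_prop
  have hK : IsCompact (Metric.sphere (0 : m → ℝ) 1 ∩ (V : Set (m → ℝ))) :=
    (isCompact_sphere _ _).inter_right V.closed_of_finiteDimensional
  have h1 : ∀ᶠ H in nhds G₀, ∀ x ∈ Metric.sphere (0 : m → ℝ) 1 ∩ (V : Set (m → ℝ)),
      x ⬝ᵥ H *ᵥ x < 0 := by
    refine hK.eventually_forall_of_forall_eventually fun x hx => ?_
    refine (hcont.tendsto (G₀, x)).eventually_lt_const ?_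
    have hx0 : x ≠ 0 := by
      rintro rfl; simp at hx
    have := hneg ⟨x, hx.2⟩ (by simpa using hx0)
    simpa [QuadraticMap.restrict_apply, quadForm_apply] using this
  filter_upwards [hG.eventually h1, hs] with t ht hst
  rw [negIndex_eq_sigNeg h₀, negIndex_eq_sigNeg hst, ← hV]
  refine le_sigNeg_of_negDef _ fun x hx => ?_
  have hx0 : (x : m → ℝ) ≠ 0 := by simpa using hx
  have hn : ‖(x : m → ℝ)‖ ≠ 0 := norm_ne_zero_iff.2 hx0
  have := ht (‖(x : m → ℝ)‖⁻¹ • (x : m → ℝ)) ⟨by simp [norm_smul, hn], V.smul_mem _ x.2⟩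
  rw [Matrix.mulVec_smul, dotProduct_smul, smul_dotProduct, smul_eq_mul, smul_eq_mul,
    ← mul_assoc] at this
  have h2 : 0 < ‖(x : m → ℝ)‖⁻¹ * ‖(x : m → ℝ)‖⁻¹ := by positivity
  have h3 : (x : m → ℝ) ⬝ᵥ G t *ᵥ x < 0 := by
    by_contra hc
    exact absurd (mul_nonneg h2.le (not_lt.1 hc)) (not_le.2 this)
  simpa [QuadraticMap.restrict_apply, quadForm_apply] using h3

/-- The indices of `G` and `-G` are both lower semicontinuous, and their sum is the fixed rank, so
neither can jump. -/
theorem eventually_negIndex_eq {T : Type*} [TopologicalSpace T] {l : Filter T}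
    {G : T → Matrix m m ℝ} {G₀ : Matrix m m ℝ} (hG : Filter.Tendsto G l (nhds G₀))
    (hs : ∀ᶠ t in l, (G t)ᵀ = G t) (h₀ : G₀ᵀ = G₀) (hr : ∀ᶠ t in l, (G t).rank = G₀.rank) :
    ∀ᶠ t in l, negIndex (G t) = negIndex G₀ := by
  have h1 := eventually_negIndex_le hG hs h₀
  have h2 := eventually_negIndex_le hG.neg (by simpa using hs) (by simpa using h₀)
  filter_upwards [h1, h2, hs, hr] with t h1 h2 h3 h4
  have := negIndex_add_negIndex_neg h3
  have := negIndex_add_negIndex_neg h₀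
  omega

end Inertia

/-! ### Pseudoinverses and their projections -/

section Pinv

variable {m k : Type*} [Fintype m] [Fintype k]

theorem pinv_transpose (A : Matrix m k ℝ) : pinv Aᵀ = (pinv A)ᵀ := by
  obtain ⟨h1, h2, h3, h4⟩ := pinv_spec A
  refine (pinv_spec _).unique ⟨?_, ?_, ?_, ?_⟩
  · simp only [← Matrix.transpose_mul, ← Matrix.mul_assoc, h1]
  · simp only [← Matrix.transpose_mul, ← Matrix.mul_assoc, h2]
  · rw [← Matrix.transpose_mul, h4, h4]
  · rw [← Matrix.transpose_mul, h3, h3]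

theorem pinv_neg (A : Matrix m k ℝ) : pinv (-A) = -pinv A := by
  obtain ⟨h1, h2, h3, h4⟩ := pinv_spec A
  exact (pinv_spec _).unique
    ⟨by simpa using h1, by simpa using h2, by simpa using h3, by simpa using h4⟩

theorem mul_pinv_eq_pinv_mul {A : Matrix m m ℝ} (hA : Aᵀ = A) : A * pinv A = pinv A * A := by
  have h := (pinv_spec A).symm_left
  rw [Matrix.transpose_mul, ← pinv_transpose, hA] at h
  exact h.symm

/-- The orthogonal projection `A† A` depends on the row space of `A` only. -/
theorem pinv_mul_self_congr {l : Type*} [Fintype l]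
    {A : Matrix m k ℝ} {B : Matrix l k ℝ} {C : Matrix m l ℝ} {D : Matrix l m ℝ}
    (hA : A = C * B) (hB : B = D * A) : pinv A * A = pinv B * B := by
  have h1 : (pinv A * A) * (pinv B * B) = pinv A * A := by
    have : A * (pinv B * B) = A := by
      rw [hA, Matrix.mul_assoc, ← Matrix.mul_assoc B, (pinv_spec B).mul_mul_left]
    rw [Matrix.mul_assoc, this]
  have h2 : (pinv B * B) * (pinv A * A) = pinv B * B := by
    have : B * (pinv A * A) = B := by
      rw [hB, Matrix.mul_assoc, ← Matrix.mul_assoc A, (pinv_spec A).mul_mul_left]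
    rw [Matrix.mul_assoc, this]
  have h3 := congrArg Matrix.transpose h1
  rw [Matrix.transpose_mul, (pinv_spec A).symm_right, (pinv_spec B).symm_right, h2] at h3
  exact h3.symm

end Pinv

/-! ### Inertia of block matrices -/

section Blocks

variable {m k : Type*} [Fintype m] [DecidableEq m] [Fintype k] [DecidableEq k]

theorem rank_fromBlocks_diagonal {A : Matrix m m ℝ} {D : Matrix k k ℝ} (hA : Aᵀ = A)
    (hD : Dᵀ = D) : (fromBlocks A 0 0 D).rank = A.rank + D.rank := by
  have h : (fromBlocks A 0 0 D)ᵀ = fromBlocks A 0 0 D := by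
    simp [fromBlocks_transpose, hA, hD]
  rw [← negIndex_add_negIndex_neg h, ← negIndex_add_negIndex_neg hA,
    ← negIndex_add_negIndex_neg hD, fromBlocks_neg, neg_zero, neg_zero,
    negIndex_fromBlocks_diagonal, negIndex_fromBlocks_diagonal]
  omega

/-- Conjugation by `diag(1, -1)` changes the sign of the matrix, so its negative index is half of
its rank `2 rank M`. -/
theorem negIndex_offDiagonal (M : Matrix m k ℝ) :
    negIndex (fromBlocks 0 M Mᵀ 0) = M.rank := by
  have hs : (fromBlocks 0 M Mᵀ 0)ᵀ = fromBlocks 0 M Mᵀ 0 := by simp [fromBlocks_transpose]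
  have hneg : negIndex (-fromBlocks 0 M Mᵀ 0) = negIndex (fromBlocks 0 M Mᵀ 0) := by
    have hu : IsUnit (fromBlocks (1 : Matrix m m ℝ) 0 0 (-1 : Matrix k k ℝ)) :=
      IsUnit.of_mul_eq_one (fromBlocks (1 : Matrix m m ℝ) 0 0 (-1 : Matrix k k ℝ))
        (by simp [fromBlocks_multiply])
    rw [← negIndex_congruence hs hu]
    congr 1
    simp [fromBlocks_multiply, fromBlocks_transpose, fromBlocks_neg]
  have hr : (fromBlocks 0 M Mᵀ 0).rank = M.rank + M.rank := by
    rw [← rank_transpose_mul_self, hs, fromBlocks_multiply]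
    simp only [Matrix.zero_mul, Matrix.mul_zero, zero_add, add_zero]
    rw [rank_fromBlocks_diagonal (by simp) (by simp), rank_self_mul_transpose,
      rank_transpose_mul_self]
  have := negIndex_add_negIndex_neg hs
  omega

/-- The inertia of a bordered matrix. -/
theorem negIndex_bordered {M : Matrix m k ℝ} {S : Matrix k k ℝ} (hS : Sᵀ = S) :
    negIndex (fromBlocks 0 M Mᵀ S) =
      M.rank + negIndex ((1 - pinv M * M) * S * (1 - pinv M * M)) := by
  obtain ⟨h1, -, -, h4⟩ := pinv_spec M
  set E := pinv M * M with hE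
  set V := 1 - E with hV
  have hVt : Vᵀ = V := by simp [hV, h4]
  have hMV : M * V = 0 := by rw [hV, Matrix.mul_sub, hE, ← Matrix.mul_assoc, h1]; simp
  have hEE : E * E = E := by
    rw [hE, Matrix.mul_assoc, ← Matrix.mul_assoc M, h1]
  have hs : (fromBlocks 0 M Mᵀ S)ᵀ = fromBlocks 0 M Mᵀ S := by simp [fromBlocks_transpose, hS]
  -- `L` is chosen so that `L + Lᵀ + S = V S V`; the term `E S E` is shared equally between `L` and
  -- `Lᵀ`. As `E L = L`, it factors as `Mᵀ K`, so a block shear by `K` removes all of `S` but `V S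
  -- V`.
  set L := -((1 / 2 : ℝ) • (E * S * E) + E * S * V) with hL
  have hEL : E * L = L := by
    simp only [hL, Matrix.mul_neg, Matrix.mul_add, Matrix.mul_smul, ← Matrix.mul_assoc, hEE]
  set K := (pinv M)ᵀ * L with hK
  have hMK : Mᵀ * K = L := by
    rw [hK, ← Matrix.mul_assoc, ← Matrix.transpose_mul, ← hE, h4, hEL]
  have hKM : Kᵀ * M = Lᵀ := by
    rw [← hMK]; simp
  have hLL : L + Lᵀ + S = V * S * V := by
    have hLt : Lᵀ = -((1 / 2 : ℝ) • (E * S * E) + V * S * E) := by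
      simp [hL, Matrix.transpose_mul, h4, hS, hVt, Matrix.mul_assoc]
    have hdec : S = (E + V) * S * (E + V) := by simp [hV]
    have hhalf : (1 / 2 : ℝ) • (E * S * E) + (1 / 2 : ℝ) • (E * S * E) = E * S * E := by
      rw [← add_smul]; norm_num
    have hx : (E + V) * S * (E + V) = E * S * E + E * S * V + V * S * E + V * S * V := by
      simp only [Matrix.add_mul, Matrix.mul_add]; abel
    have hS' := hdec.trans hx
    calc L + Lᵀ + S = L + Lᵀ + (E * S * E + E * S * V + V * S * E + V * S * V) := by
          rw [← hS']
      _ = V * S * V := by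
          rw [hLt, hL]
          nth_rewrite 3 [← hhalf]
          abel
  have hu : IsUnit (fromBlocks (1 : Matrix m m ℝ) K 0 (1 : Matrix k k ℝ)) :=
    IsUnit.of_mul_eq_one (fromBlocks (1 : Matrix m m ℝ) (-K) 0 (1 : Matrix k k ℝ))
      (by simp [fromBlocks_multiply])
  rw [← negIndex_congruence hs hu]
  have : (fromBlocks (1 : Matrix m m ℝ) K 0 (1 : Matrix k k ℝ))ᵀ * fromBlocks 0 M Mᵀ S *
      fromBlocks (1 : Matrix m m ℝ) K 0 (1 : Matrix k k ℝ) =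
      fromBlocks 0 M Mᵀ 0 + fromBlocks 0 0 0 (V * S * V) := by
    rw [fromBlocks_transpose, fromBlocks_multiply, fromBlocks_multiply, fromBlocks_add, ← hLL]
    simp [hMK, hKM, add_assoc]
  rw [this, negIndex_add_of_mul_eq_zero, negIndex_offDiagonal, negIndex_fromBlocks_diagonal,
    negIndex_zero, zero_add]
  rw [fromBlocks_multiply]
  simp [← Matrix.mul_assoc, hMV]

/-- Inertia additivity for the generalized Schur complement. -/
theorem negIndex_schur {A : Matrix m m ℝ} {B : Matrix m k ℝ} {D : Matrix k k ℝ}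
    (hA : Aᵀ = A) (hD : Dᵀ = D) :
    negIndex (fromBlocks A B Bᵀ D) = negIndex A +
      negIndex (fromBlocks 0 ((1 - A * pinv A) * B) ((1 - A * pinv A) * B)ᵀ
        (D - Bᵀ * pinv A * B)) := by
  obtain ⟨h1, h2, h3, -⟩ := pinv_spec A
  have hc := mul_pinv_eq_pinv_mul hA
  have hpt : (pinv A)ᵀ = pinv A := by rw [← pinv_transpose, hA]
  have hs : (fromBlocks A B Bᵀ D)ᵀ = fromBlocks A B Bᵀ D := by
    simp [fromBlocks_transpose, hA, hD]
  -- Block elimination with `A†` in place of an inverse. The part of `B` outside the range of `A`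
  -- survives off the diagonal; the two remaining summands multiply to zero, so their indices add.
  have hu : IsUnit (fromBlocks (1 : Matrix m m ℝ) (-(pinv A * B)) 0 (1 : Matrix k k ℝ)) :=
    IsUnit.of_mul_eq_one (fromBlocks (1 : Matrix m m ℝ) (pinv A * B) 0 (1 : Matrix k k ℝ))
      (by simp [fromBlocks_multiply])
  have hM : B - A * (pinv A * B) = (1 - A * pinv A) * B := by
    rw [Matrix.sub_mul, Matrix.one_mul, Matrix.mul_assoc]
  have hMt : Bᵀ - Bᵀ * pinv A * A = ((1 - A * pinv A) * B)ᵀ := by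
    rw [Matrix.transpose_mul, Matrix.transpose_sub, h3, hc, Matrix.mul_sub, Matrix.transpose_one,
      Matrix.mul_one, Matrix.mul_assoc]
  have hz : Bᵀ * pinv A * A * (pinv A * B) = Bᵀ * pinv A * B := by
    rw [Matrix.mul_assoc Bᵀ, Matrix.mul_assoc Bᵀ, ← Matrix.mul_assoc _ (pinv A) B, h2,
      ← Matrix.mul_assoc]
  have : (fromBlocks (1 : Matrix m m ℝ) (-(pinv A * B)) 0 (1 : Matrix k k ℝ))ᵀ *
      fromBlocks A B Bᵀ D *
      fromBlocks (1 : Matrix m m ℝ) (-(pinv A * B)) 0 (1 : Matrix k k ℝ) =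
      fromBlocks A 0 0 0 + fromBlocks 0 ((1 - A * pinv A) * B) ((1 - A * pinv A) * B)ᵀ
        (D - Bᵀ * pinv A * B) := by
    rw [← hMt, ← hM, fromBlocks_transpose, fromBlocks_multiply, fromBlocks_multiply,
      fromBlocks_add]
    congr 1
    · simp
    · simp [sub_eq_neg_add]
    · simp [Matrix.transpose_mul, hpt, sub_eq_neg_add]
    · simp only [Matrix.transpose_neg, Matrix.transpose_mul, hpt, Matrix.transpose_one,
        Matrix.one_mul, Matrix.mul_one, Matrix.neg_mul, Matrix.mul_neg, Matrix.add_mul,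
        zero_add, ← Matrix.mul_assoc]
      rw [Matrix.mul_assoc _ (pinv A) B, hz]
      abel
  rw [← negIndex_congruence hs hu, this, negIndex_add_of_mul_eq_zero,
    negIndex_fromBlocks_diagonal, negIndex_zero, add_zero]
  rw [fromBlocks_multiply]
  have : A * ((1 - A * pinv A) * B) = 0 := by
    rw [← Matrix.mul_assoc, Matrix.mul_sub, hc, ← Matrix.mul_assoc, h1]; simp
  simp [this]

/-- `diag(A - B, B)` is congruent to `[A, B; B, B]`, whose index the generalized Schur complement
also computes. -/
theorem negIndex_sub_add {A B : Matrix m m ℝ} (hA : Aᵀ = A) (hB : Bᵀ = B) :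
    negIndex (A - B) + negIndex B = negIndex A +
      negIndex (fromBlocks 0 ((1 - A * pinv A) * B) ((1 - A * pinv A) * B)ᵀ
        (B - B * pinv A * B)) := by
  have h := negIndex_schur (B := B) hA hB
  rw [hB] at h
  rw [← h, ← negIndex_fromBlocks_diagonal]
  have hu : IsUnit (fromBlocks (1 : Matrix m m ℝ) 0 1 (1 : Matrix m m ℝ)) :=
    IsUnit.of_mul_eq_one (fromBlocks (1 : Matrix m m ℝ) 0 (-1) (1 : Matrix m m ℝ))
      (by simp [fromBlocks_multiply])
  have hs : (fromBlocks (A - B) 0 0 B)ᵀ = fromBlocks (A - B) 0 0 B := by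
    simp [fromBlocks_transpose, hA, hB]
  rw [← negIndex_congruence hs hu]
  congr 1
  simp [fromBlocks_multiply, fromBlocks_transpose]

end Blocks

/-! ### The comparative index in chart coordinates -/

section Chart

variable {m : Type*} [Fintype m] [DecidableEq m]

theorem rank_neg_eq (A : Matrix m m ℝ) : (-A).rank = A.rank := by
  have h : IsUnit (-1 : Matrix m m ℝ).det :=
    (Matrix.isUnit_iff_isUnit_det _).1 isUnit_one.neg
  rw [← Matrix.rank_mul_eq_left_of_isUnit_det (-1) A h, Matrix.mul_neg, Matrix.mul_one]

theorem mul_left_inv_of_isUnit {N : Matrix m m ℝ} (hN : IsUnit N) : N * N⁻¹ = 1 :=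
  Matrix.mul_nonsing_inv _ ((Matrix.isUnit_iff_isUnit_det _).1 hN)

/-- Here `A N` and `B K` play the upper blocks and `Nᵀ (A - B) K` the Wronskian. With `Q = 1 - A
A†`, the matrices `M` and `Q B K` have the same row space, hence the same rank and the same `V`. The
columns of `B K V` lie in the range of `A`, which turns the `P`-term into `V Kᵀ (B - B A† B) K V`;
the bordered formula and `negIndex_sub_add` finish. -/
theorem rank_add_negIndex_chart {A B N K M V : Matrix m m ℝ} (hA : Aᵀ = A) (hB : Bᵀ = B)
    (hN : IsUnit N) (hK : IsUnit K)
    (hM : M = (1 - pinv (A * N) * (A * N)) * (Nᵀ * (A - B) * K)) (hV : V = 1 - pinv M * M) :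
    M.rank + negIndex (V * (Nᵀ * (A - B) * K)ᵀ * pinv (A * N) * (B * K) * V) + negIndex A =
      negIndex (A - B) + negIndex B := by
  set X := A * N with hX
  have hNi := mul_left_inv_of_isUnit hN
  have hNti : (N⁻¹)ᵀ * Nᵀ = 1 := by rw [← Matrix.transpose_mul, hNi, Matrix.transpose_one]
  obtain ⟨x1, -, -, x4⟩ := pinv_spec X
  obtain ⟨a1, -, a3, -⟩ := pinv_spec A
  have hc := mul_pinv_eq_pinv_mul hA
  have hXt : Xᵀ = Nᵀ * A := by rw [hX, Matrix.transpose_mul, hA]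
  have hAX : A = X * N⁻¹ := by rw [hX, Matrix.mul_assoc, hNi, Matrix.mul_one]
  set F := 1 - pinv X * X with hF
  set Q := 1 - A * pinv A with hQ
  clear_value X F Q
  have hQA : Q * A = 0 := by rw [hQ, Matrix.sub_mul, a1, Matrix.one_mul, sub_self]
  have hXX : pinv X * X = Nᵀ * (A * (pinv X)ᵀ) := by
    rw [← x4, Matrix.transpose_mul, hXt, Matrix.mul_assoc]
  have hFN : F * (Nᵀ * A) = 0 := by
    rw [← hXt, hF, ← x4, Matrix.sub_mul, ← Matrix.transpose_mul, ← Matrix.mul_assoc, x1]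
    simp
  have hM' : M = F * (Nᵀ * -(B * K)) := by
    have : Nᵀ * (A - B) * K = Nᵀ * A * K - Nᵀ * (B * K) := by
      rw [Matrix.mul_sub, Matrix.sub_mul, Matrix.mul_assoc Nᵀ B]
    rw [hM, this, Matrix.mul_sub, ← Matrix.mul_assoc F, hFN]
    simp
  have hFQ : F * Nᵀ = F * Nᵀ * Q := by
    rw [hQ, Matrix.mul_sub, Matrix.mul_one, ← Matrix.mul_assoc, Matrix.mul_assoc F, hFN]
    simp
  have hM1 : M = -(F * Nᵀ) * (Q * (B * K)) := by
    calc M = F * Nᵀ * -(B * K) := by rw [hM', Matrix.mul_assoc]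
      _ = F * Nᵀ * Q * -(B * K) := by rw [← hFQ]
      _ = -(F * Nᵀ) * (Q * (B * K)) := by simp [Matrix.mul_assoc]
  -- Recovers `Q` from `F Nᵀ`, so that `M` and `Q B K` are left multiples of each other.
  have hQF : Q * (N⁻¹)ᵀ * (F * Nᵀ) = Q := by
    rw [hF, Matrix.sub_mul, Matrix.one_mul, Matrix.mul_sub, Matrix.mul_assoc Q, hNti, hXX,
      Matrix.mul_one, Matrix.mul_assoc Nᵀ, Matrix.mul_assoc Q, ← Matrix.mul_assoc _ Nᵀ, hNti,
      Matrix.one_mul, Matrix.mul_assoc A, ← Matrix.mul_assoc Q, hQA]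
    simp
  have hM2 : Q * (B * K) = -(Q * (N⁻¹)ᵀ) * M := by
    rw [hM']
    conv_lhs => rw [← hQF]
    simp [Matrix.mul_assoc]
  have hrank : M.rank = (Q * (B * K)).rank := by
    apply le_antisymm
    · rw [hM1]; exact Matrix.rank_mul_le_right _ _
    · rw [hM2]; exact Matrix.rank_mul_le_right _ _
  have hproj := pinv_mul_self_congr hM1 hM2
  have hVt : Vᵀ = V := by
    rw [hV, Matrix.transpose_sub, (pinv_spec M).symm_right, Matrix.transpose_one]
  have hQV : Q * (B * K * V) = 0 := by
    rw [← Matrix.mul_assoc Q, hV, hproj, Matrix.mul_sub, ← Matrix.mul_assoc _ (pinv _),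
      (pinv_spec _).mul_mul_left, Matrix.mul_one, sub_self]
  have hBV : B * K * V = A * pinv A * (B * K * V) := by
    rw [hQ, Matrix.sub_mul, Matrix.one_mul, sub_eq_zero] at hQV
    exact hQV
  have hXBV : X * pinv X * (B * K * V) = B * K * V := by
    have : X * pinv X * A = A := by
      conv_lhs => rw [hAX]
      rw [← Matrix.mul_assoc, x1, ← hAX]
    rw [hBV, Matrix.mul_assoc A, ← Matrix.mul_assoc _ A, this]
  have hVB : V * (Kᵀ * B) = V * (Kᵀ * B) * (pinv A * A) := by
    have h := congrArg Matrix.transpose hBV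
    rwa [Matrix.transpose_mul (A * pinv A), a3, hc, Matrix.transpose_mul, Matrix.transpose_mul,
      hVt, hB] at h
  have hP : V * (Nᵀ * (A - B) * K)ᵀ * pinv X * (B * K) * V =
      V * (Kᵀ * (B - B * pinv A * B) * K) * V := by
    have e1 : V * (Nᵀ * (A - B) * K)ᵀ * pinv X * (B * K) * V =
        V * Kᵀ * (X * pinv X * (B * K * V)) - V * (Kᵀ * B) * (N * (pinv X * (B * K * V))) := by
      rw [Matrix.transpose_mul, Matrix.transpose_mul, Matrix.transpose_sub, hA, hB,
        Matrix.transpose_transpose, Matrix.sub_mul, Matrix.mul_sub, ← hX, Matrix.mul_sub,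
        Matrix.sub_mul, Matrix.sub_mul, Matrix.sub_mul]
      simp only [Matrix.mul_assoc]
    have e2 : V * (Kᵀ * B) * (N * (pinv X * (B * K * V))) =
        V * (Kᵀ * B) * pinv A * (B * K * V) := by
      conv_lhs => rw [hVB]
      rw [← Matrix.mul_assoc _ (pinv A) A, Matrix.mul_assoc _ A, ← Matrix.mul_assoc A N, ← hX,
        ← Matrix.mul_assoc X, hXBV]
    rw [e1, e2, hXBV]
    simp only [Matrix.mul_assoc, Matrix.mul_sub, Matrix.sub_mul]
  have hpt : (pinv A)ᵀ = pinv A := by rw [← pinv_transpose, hA]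
  have hSt : (B - B * pinv A * B)ᵀ = B - B * pinv A * B := by
    simp [Matrix.transpose_mul, hB, hpt, Matrix.mul_assoc]
  have hSKt : (Kᵀ * (B - B * pinv A * B) * K)ᵀ = Kᵀ * (B - B * pinv A * B) * K := by
    rw [Matrix.transpose_mul, Matrix.transpose_mul, hSt, Matrix.transpose_transpose,
      ← Matrix.mul_assoc]
  have hb := negIndex_bordered (M := Q * (B * K)) hSKt
  rw [← hproj, ← hV, ← hrank, ← hP] at hb
  have hs := negIndex_sub_add hA hB
  rw [hs, ← hb, add_comm, ← hQ]
  congr 1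
  obtain ⟨K', hK'⟩ := hK.exists_right_inv
  have hu : IsUnit (fromBlocks (1 : Matrix m m ℝ) 0 0 K) :=
    IsUnit.of_mul_eq_one (fromBlocks (1 : Matrix m m ℝ) 0 0 K')
      (by simp [fromBlocks_multiply, hK'])
  have hsy : (fromBlocks 0 (Q * B) (Q * B)ᵀ (B - B * pinv A * B))ᵀ =
      fromBlocks 0 (Q * B) (Q * B)ᵀ (B - B * pinv A * B) := by
    rw [fromBlocks_transpose, hSt]; simp
  rw [← negIndex_congruence hsy hu, fromBlocks_transpose, fromBlocks_multiply,
    fromBlocks_multiply]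
  simp [Matrix.mul_assoc]

end Chart

/-! ### Affine charts of Lagrangian planes -/

section Plane

variable {n : ℕ}

/-- The denominator `U - s X` of the affine chart of planes transversal to `[I; s I]`. -/
def chartDen (s : ℝ) (Y : Matrix (Fin n ⊕ Fin n) (Fin n) ℝ) : Matrix (Fin n) (Fin n) ℝ :=
  Y.toRows₂ - s • Y.toRows₁

/-- The matrix `X (U - s X)⁻¹` representing the plane of `Y` in the affine chart of planes
transversal to `[I; s I]`. -/
noncomputable def chart (s : ℝ) (Y : Matrix (Fin n ⊕ Fin n) (Fin n) ℝ) :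
    Matrix (Fin n) (Fin n) ℝ :=
  Y.toRows₁ * (chartDen s Y)⁻¹

theorem wronskian_eq (Y Z : Matrix (Fin n ⊕ Fin n) (Fin n) ℝ) :
    wronskian Y Z = Y.toRows₁ᵀ * Z.toRows₂ - Y.toRows₂ᵀ * Z.toRows₁ := by
  conv_lhs => rw [wronskian, stdJ, ← fromRows_toRows Y, ← fromRows_toRows Z]
  rw [transpose_fromRows, Matrix.mul_assoc, fromBlocks_mul_fromRows, fromCols_mul_fromRows]
  simp [sub_eq_add_neg]

theorem transpose_mul_chartDen (s : ℝ) (Y Z : Matrix (Fin n ⊕ Fin n) (Fin n) ℝ) :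
    Y.toRows₁ᵀ * chartDen s Z - (chartDen s Y)ᵀ * Z.toRows₁ = wronskian Y Z := by
  rw [wronskian_eq, chartDen, chartDen, Matrix.transpose_sub, Matrix.transpose_smul,
    Matrix.mul_sub, Matrix.sub_mul, Matrix.mul_smul, Matrix.smul_mul]
  abel

theorem chart_mul_chartDen {s : ℝ} {Y : Matrix (Fin n ⊕ Fin n) (Fin n) ℝ}
    (hN : IsUnit (chartDen s Y)) : chart s Y * chartDen s Y = Y.toRows₁ := by
  rw [chart, Matrix.mul_assoc,
    Matrix.nonsing_inv_mul _ ((Matrix.isUnit_iff_isUnit_det _).1 hN), Matrix.mul_one]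

theorem chart_transpose {s : ℝ} {Y : Matrix (Fin n ⊕ Fin n) (Fin n) ℝ}
    (hY : wronskian Y Y = 0) (hN : IsUnit (chartDen s Y)) : (chart s Y)ᵀ = chart s Y := by
  have h := transpose_mul_chartDen s Y Y
  rw [hY, sub_eq_zero] at h
  have h2 := mul_left_inv_of_isUnit hN
  have h3 : ((chartDen s Y)⁻¹)ᵀ * (chartDen s Y)ᵀ = 1 := by
    rw [← Matrix.transpose_mul, h2, Matrix.transpose_one]
  calc (chart s Y)ᵀ = ((chartDen s Y)⁻¹)ᵀ * (Y.toRows₁ᵀ * chartDen s Y) * (chartDen s Y)⁻¹ := by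
        rw [Matrix.mul_assoc, Matrix.mul_assoc, h2, Matrix.mul_one, chart, Matrix.transpose_mul]
    _ = chart s Y := by
        rw [h, ← Matrix.mul_assoc, h3, Matrix.one_mul, chart]

theorem wronskian_eq_chart {s : ℝ} {Y Z : Matrix (Fin n ⊕ Fin n) (Fin n) ℝ}
    (hY : wronskian Y Y = 0) (hN : IsUnit (chartDen s Y)) (hK : IsUnit (chartDen s Z)) :
    wronskian Y Z = (chartDen s Y)ᵀ * (chart s Y - chart s Z) * chartDen s Z := by
  have h : (chartDen s Y)ᵀ * chart s Y = Y.toRows₁ᵀ := by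
    rw [← chart_mul_chartDen hN, Matrix.transpose_mul, chart_transpose hY hN]
  rw [← transpose_mul_chartDen s, Matrix.mul_sub, Matrix.sub_mul, h, Matrix.mul_assoc,
    chart_mul_chartDen hK]

theorem compIndex_add_negIndex_chart {s : ℝ} {Y Z : Matrix (Fin n ⊕ Fin n) (Fin n) ℝ}
    (hY : wronskian Y Y = 0) (hZ : wronskian Z Z = 0) (hN : IsUnit (chartDen s Y))
    (hK : IsUnit (chartDen s Z)) :
    compIndex Y Z + negIndex (chart s Y) =
      negIndex (chart s Y - chart s Z) + negIndex (chart s Z) := by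
  have hM : ciM Y Z = (1 - pinv (chart s Y * chartDen s Y) * (chart s Y * chartDen s Y)) *
      ((chartDen s Y)ᵀ * (chart s Y - chart s Z) * chartDen s Z) := by
    rw [chart_mul_chartDen hN, ← wronskian_eq_chart hY hN hK, ciM]
  have h := rank_add_negIndex_chart (chart_transpose hY hN) (chart_transpose hZ hK) hN hK hM rfl
  rwa [chart_mul_chartDen hN, ← wronskian_eq_chart hY hN hK, chart_mul_chartDen hK] at h

/-- The same computation for `-A` and `-B`: `M` changes sign, `V` does not, and the three sign
changes in `W`, `X†` and the upper block of `Z` turn `P` into `-P`. -/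
theorem dualCompIndex_add_negIndex_chart {s : ℝ} {Y Z : Matrix (Fin n ⊕ Fin n) (Fin n) ℝ}
    (hY : wronskian Y Y = 0) (hZ : wronskian Z Z = 0) (hN : IsUnit (chartDen s Y))
    (hK : IsUnit (chartDen s Z)) :
    dualCompIndex Y Z + negIndex (-chart s Y) =
      negIndex (-(chart s Y - chart s Z)) + negIndex (-chart s Z) := by
  have hW : (chartDen s Y)ᵀ * (-chart s Y - -chart s Z) * chartDen s Z = -wronskian Y Z := by
    rw [wronskian_eq_chart hY hN hK, ← Matrix.neg_mul, ← Matrix.mul_neg, neg_sub_neg, neg_sub]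
  have hM : -ciM Y Z =
      (1 - pinv (-chart s Y * chartDen s Y) * (-chart s Y * chartDen s Y)) *
      ((chartDen s Y)ᵀ * (-chart s Y - -chart s Z) * chartDen s Z) := by
    rw [hW, Matrix.neg_mul, chart_mul_chartDen hN, pinv_neg, ciM, Matrix.mul_neg, neg_mul_neg]
  have hV : ciV Y Z = 1 - pinv (-ciM Y Z) * -ciM Y Z := by
    rw [pinv_neg, neg_mul_neg, ciV]
  have h := rank_add_negIndex_chart (A := -chart s Y) (B := -chart s Z)
    (by rw [Matrix.transpose_neg, chart_transpose hY hN])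
    (by rw [Matrix.transpose_neg, chart_transpose hZ hK]) hN hK hM hV
  rw [hW, Matrix.neg_mul, chart_mul_chartDen hN, Matrix.neg_mul, chart_mul_chartDen hK,
    rank_neg_eq, pinv_neg] at h
  have h2 : -(chart s Y - chart s Z) = -chart s Y - -chart s Z := by abel
  rw [h2, ← h, dualCompIndex, ciP, ind_eq_negIndex]
  simp

theorem rank_chart {s : ℝ} {Y : Matrix (Fin n ⊕ Fin n) (Fin n) ℝ}
    (hN : IsUnit (chartDen s Y)) : (chart s Y).rank = Y.toRows₁.rank := by
  rw [← chart_mul_chartDen hN, Matrix.rank_mul_eq_left_of_isUnit_det _ _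
    ((Matrix.isUnit_iff_isUnit_det _).1 hN)]

theorem rank_wronskian_eq_chart {s : ℝ} {Y Z : Matrix (Fin n ⊕ Fin n) (Fin n) ℝ}
    (hY : wronskian Y Y = 0) (hN : IsUnit (chartDen s Y)) (hK : IsUnit (chartDen s Z)) :
    (wronskian Y Z).rank = (chart s Y - chart s Z).rank := by
  rw [wronskian_eq_chart hY hN hK, Matrix.rank_mul_eq_left_of_isUnit_det _ _
    ((Matrix.isUnit_iff_isUnit_det _).1 hK), Matrix.rank_mul_eq_right_of_isUnit_det _ _
    ((Matrix.isUnit_iff_isUnit_det _).1 (by simpa using hN))]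

theorem isUnit_transpose_mul_self {Y : Matrix (Fin n ⊕ Fin n) (Fin n) ℝ} (hY : Y.rank = n) :
    IsUnit (Yᵀ * Y) := by
  rw [← Matrix.rank_transpose_mul_self] at hY
  rw [← Matrix.mulVec_surjective_iff_isUnit]
  have : LinearMap.range (Yᵀ * Y).mulVecLin = ⊤ :=
    Submodule.eq_top_of_finrank_eq (by simpa [Matrix.rank] using hY)
  exact LinearMap.range_eq_top.1 this

theorem transpose_mul_of_isSymm {P Q : Matrix (Fin n) (Fin n) ℂ} (h : Pᵀ * Q = Qᵀ * P) :
    (Q + Complex.I • P)ᵀ * (Q - Complex.I • P) = Pᵀ * P + Qᵀ * Q := by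
  simp only [Matrix.transpose_add, Matrix.transpose_smul, Matrix.add_mul, Matrix.mul_sub,
    Matrix.mul_smul, Matrix.smul_mul, smul_add, smul_smul, Complex.I_mul_I, h, neg_smul, one_smul]
  abel

open Polynomial in
-- The bad `s` are roots of the polynomial `det (U - s X)`. It is nonzero at `s = i`, because the
-- Lagrangian condition gives `(U + i X)ᵀ (U - i X) = Yᵀ Y`, which is invertible.
theorem finite_not_isUnit_chartDen {Y : Matrix (Fin n ⊕ Fin n) (Fin n) ℝ}
    (hY : IsLagrangianPlane Y) : {s : ℝ | ¬IsUnit (chartDen s Y)}.Finite := by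
  set p : ℝ[X] := (Y.toRows₂.map C - (X : ℝ[X]) • Y.toRows₁.map C).det with hp
  have heval : ∀ s : ℝ, p.eval s = (chartDen s Y).det := by
    intro s
    rw [hp, ← Polynomial.coe_evalRingHom, RingHom.map_det]
    congr 1
    ext i j
    simp [chartDen]
    exact mul_comm _ _
  have hI : p.aeval Complex.I ≠ 0 := by
    have h1 : p.aeval Complex.I =
        (Y.toRows₂.map Complex.ofReal - Complex.I • Y.toRows₁.map Complex.ofReal).det := by
      rw [hp, ← AlgHom.coe_toRingHom, RingHom.map_det]
      congr 1
      ext i j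
      simp
      exact mul_comm _ _
    rw [h1]
    have h2 : (Y.toRows₂.map Complex.ofReal + Complex.I • Y.toRows₁.map Complex.ofReal)ᵀ *
        (Y.toRows₂.map Complex.ofReal - Complex.I • Y.toRows₁.map Complex.ofReal) =
        (Yᵀ * Y).map Complex.ofRealHom := by
      have hw := congrArg (fun G => G.map Complex.ofRealHom) hY.1
      have hyy : Yᵀ * Y = Y.toRows₁ᵀ * Y.toRows₁ + Y.toRows₂ᵀ * Y.toRows₂ := by
        conv_lhs => rw [← fromRows_toRows Y]
        rw [transpose_fromRows, fromCols_mul_fromRows]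
      simp only [wronskian_eq, Matrix.map_sub _ (map_sub Complex.ofRealHom), Matrix.map_mul,
        Matrix.map_zero _ (map_zero Complex.ofRealHom), sub_eq_zero] at hw
      rw [hyy, Matrix.map_add _ (map_add Complex.ofRealHom), Matrix.map_mul, Matrix.map_mul]
      exact transpose_mul_of_isSymm hw
    intro h0
    have h3 := congrArg Matrix.det h2
    rw [Matrix.det_mul, h0, mul_zero, ← RingHom.mapMatrix_apply, ← RingHom.map_det] at h3
    have h4 := (Matrix.isUnit_iff_isUnit_det _).1 (isUnit_transpose_mul_self hY.2)
    exact h4.ne_zero (by simpa using h3.symm)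
  have hp0 : p ≠ 0 := by
    rintro h; simp [h] at hI
  refine (p.roots.toFinset.finite_toSet).subset fun s hs => ?_
  simp only [Finset.mem_coe, Multiset.mem_toFinset]
  rw [Polynomial.mem_roots hp0, Polynomial.IsRoot.def, heval]
  by_contra h
  exact hs ((Matrix.isUnit_iff_isUnit_det _).2 (isUnit_iff_ne_zero.2 h))

end Plane

/-! ### Symplectic images of the vertical plane -/

section Symplectic

variable {n : ℕ}

theorem stdJ_mul_stdJ : stdJ n * stdJ n = -1 := by
  rw [stdJ, fromBlocks_multiply, ← fromBlocks_one, fromBlocks_neg]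
  simp

theorem isUnit_of_isSymplectic {R : Matrix (Fin n ⊕ Fin n) (Fin n ⊕ Fin n) ℝ}
    (hR : IsSymplectic R) : IsUnit R := by
  refine IsUnit.of_mul_eq_one_right (-(stdJ n * Rᵀ * stdJ n)) ?_
  rw [Matrix.neg_mul, Matrix.mul_assoc, Matrix.mul_assoc, ← Matrix.mul_assoc Rᵀ, hR,
    stdJ_mul_stdJ, neg_neg]

theorem isLagrangianPlane_mul_vert {R : Matrix (Fin n ⊕ Fin n) (Fin n ⊕ Fin n) ℝ}
    (hR : IsSymplectic R) : IsLagrangianPlane (R * vert n) := by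
  constructor
  · have : wronskian (R * vert n) (R * vert n) = wronskian (vert n) (vert n) := by
      calc _ = (vert n)ᵀ * (Rᵀ * stdJ n * R) * vert n := by
            rw [wronskian, Matrix.transpose_mul]
            simp only [Matrix.mul_assoc]
        _ = _ := by rw [hR, wronskian]
    rw [this, wronskian_eq]
    simp [vert]
  · rw [Matrix.rank_mul_eq_right_of_isUnit_det _ _
      ((Matrix.isUnit_iff_isUnit_det _).1 (isUnit_of_isSymplectic hR)),
      ← Matrix.rank_transpose_mul_self, vert, transpose_fromRows, fromCols_mul_fromRows]
    simp [Matrix.rank_one]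

theorem rank_wronskian_comm (Y Z : Matrix (Fin n ⊕ Fin n) (Fin n) ℝ) :
    (wronskian Y Z).rank = (wronskian Z Y).rank := by
  have : wronskian Y Z = -(wronskian Z Y)ᵀ := by
    simp [wronskian_eq, Matrix.transpose_mul]
  rw [this, rank_neg_eq, Matrix.rank_transpose]

/-- In a chart containing both planes, add the two chart identities and replace each pair of
opposite indices by a rank. -/
theorem compIndex_add_dualCompIndex {Y Z : Matrix (Fin n ⊕ Fin n) (Fin n) ℝ}
    (hY : IsLagrangianPlane Y) (hZ : IsLagrangianPlane Z) :
    compIndex Y Z + dualCompIndex Y Z + Y.toRows₁.rank =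
      (wronskian Z Y).rank + Z.toRows₁.rank := by
  obtain ⟨s, hs⟩ := ((finite_not_isUnit_chartDen hY).union
    (finite_not_isUnit_chartDen hZ)).exists_notMem
  simp only [mem_union, Set.mem_ofPred_eq, not_or, not_not] at hs
  obtain ⟨hN, hK⟩ := hs
  have hA := chart_transpose hY.1 hN
  have hB := chart_transpose hZ.1 hK
  have h1 := compIndex_add_negIndex_chart hY.1 hZ.1 hN hK
  have h2 := dualCompIndex_add_negIndex_chart hY.1 hZ.1 hN hK
  have h3 := negIndex_add_negIndex_neg hA
  have h4 := negIndex_add_negIndex_neg hB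
  have h5 := negIndex_add_negIndex_neg (G := chart s Y - chart s Z)
    (by rw [Matrix.transpose_sub, hA, hB])
  rw [rank_wronskian_comm, rank_wronskian_eq_chart hY.1 hN hK, ← rank_chart hN, ← rank_chart hK]
  omega

/-- The symplectic matrix mapping `E` to `[I; s I]`. -/
def shear (n : ℕ) (s : ℝ) : Matrix (Fin n ⊕ Fin n) (Fin n ⊕ Fin n) ℝ :=
  fromBlocks 0 1 (-1) (s • 1)

theorem isSymplectic_shear (s : ℝ) : IsSymplectic (shear n s) := by
  rw [IsSymplectic, shear, stdJ, fromBlocks_transpose, fromBlocks_multiply, fromBlocks_multiply]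
  simp

theorem wronskian_shear (s : ℝ) (Y : Matrix (Fin n ⊕ Fin n) (Fin n) ℝ) :
    wronskian (shear n s * vert n) Y = chartDen s Y := by
  rw [shear, vert, fromBlocks_mul_fromRows, wronskian_eq, chartDen]
  simp

end Symplectic

/-! ### Local behaviour along a path -/

section Local

variable {n : ℕ}

theorem continuousOn_chartDen {T : Set ℝ} {Y : ℝ → Matrix (Fin n ⊕ Fin n) (Fin n) ℝ}
    (hY : ContinuousOn Y T) (s : ℝ) : ContinuousOn (fun t => chartDen s (Y t)) T := by
  have h : Continuous fun Z : Matrix (Fin n ⊕ Fin n) (Fin n) ℝ => chartDen s Z := by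
    refine continuous_matrix fun i j => ?_
    simp only [chartDen, Matrix.sub_apply, Matrix.smul_apply, toRows₁_apply, toRows₂_apply]
    fun_prop
  exact h.comp_continuousOn hY

theorem tendsto_chart {T : Set ℝ} {Y : ℝ → Matrix (Fin n ⊕ Fin n) (Fin n) ℝ}
    (hY : ContinuousOn Y T) {s τ : ℝ} (hτ : τ ∈ T) (hs : IsUnit (chartDen s (Y τ))) :
    Filter.Tendsto (fun t => chart s (Y t)) (nhdsWithin τ T) (nhds (chart s (Y τ))) := by
  have h0 : (chartDen s (Y τ)).det ≠ 0 := ((Matrix.isUnit_iff_isUnit_det _).1 hs).ne_zero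
  have h1 : ContinuousAt Inv.inv (chartDen s (Y τ)) := by
    refine continuousAt_matrix_inv _ ?_
    rw [Ring.inverse_eq_inv']
    exact continuousAt_inv₀ h0
  have h2 := h1.tendsto.comp (continuousOn_chartDen hY s τ hτ)
  have h : Continuous fun Z : Matrix (Fin n ⊕ Fin n) (Fin n) ℝ => Z.toRows₁ :=
    continuous_matrix fun i j => by simp only [toRows₁_apply]; fun_prop
  exact ((h.tendsto _).comp (hY τ hτ)).mul h2

theorem eventually_isUnit_chartDen {T : Set ℝ} {Y : ℝ → Matrix (Fin n ⊕ Fin n) (Fin n) ℝ}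
    (hY : ContinuousOn Y T) {s τ : ℝ} (hτ : τ ∈ T) (hs : IsUnit (chartDen s (Y τ))) :
    ∀ᶠ t in nhdsWithin τ T, IsUnit (chartDen s (Y t)) := by
  have h0 : (chartDen s (Y τ)).det ≠ 0 := ((Matrix.isUnit_iff_isUnit_det _).1 hs).ne_zero
  have h1 : ContinuousOn (fun t => (chartDen s (Y t)).det) T :=
    continuous_id.matrix_det.comp_continuousOn (continuousOn_chartDen hY s)
  filter_upwards [(h1 τ hτ).eventually_ne h0] with t ht
  exact (Matrix.isUnit_iff_isUnit_det _).2 (isUnit_iff_ne_zero.2 ht)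

/-- If the ranks of `W(Z, Y)` and of the upper block of `Z` are constant, the variation of
`μ(Y, Z)` is locally minus the variation of the negative index of `Y` in an affine chart. -/
theorem eventually_compIndex_add_eq {T : Set ℝ}
    {Y Z : ℝ → Matrix (Fin n ⊕ Fin n) (Fin n) ℝ} (hYc : ContinuousOn Y T)
    (hZc : ContinuousOn Z T) (hY : ∀ t ∈ T, IsLagrangianPlane (Y t))
    (hZ : ∀ t ∈ T, IsLagrangianPlane (Z t)) {r q : ℕ}
    (hr : ∀ t ∈ T, (wronskian (Z t) (Y t)).rank = r) (hq : ∀ t ∈ T, (Z t).toRows₁.rank = q)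
    {s τ : ℝ} (hτ : τ ∈ T) (hN : IsUnit (chartDen s (Y τ))) (hK : IsUnit (chartDen s (Z τ))) :
    ∀ᶠ t in nhdsWithin τ T, compIndex (Y t) (Z t) + negIndex (chart s (Y t)) =
      compIndex (Y τ) (Z τ) + negIndex (chart s (Y τ)) := by
  have eT : ∀ᶠ t in nhdsWithin τ T, t ∈ T := self_mem_nhdsWithin
  have eN := eventually_isUnit_chartDen hYc hτ hN
  have eK := eventually_isUnit_chartDen hZc hτ hK
  have hA := chart_transpose (hY τ hτ).1 hN
  have hB := chart_transpose (hZ τ hτ).1 hK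
  have eA : ∀ᶠ t in nhdsWithin τ T, (chart s (Y t))ᵀ = chart s (Y t) := by
    filter_upwards [eT, eN] with t h1 h2 using chart_transpose (hY t h1).1 h2
  have eB : ∀ᶠ t in nhdsWithin τ T, (chart s (Z t))ᵀ = chart s (Z t) := by
    filter_upwards [eT, eK] with t h1 h2 using chart_transpose (hZ t h1).1 h2
  have rAB : ∀ t ∈ T, IsUnit (chartDen s (Y t)) → IsUnit (chartDen s (Z t)) →
      (chart s (Y t) - chart s (Z t)).rank = r := fun t h1 h2 h3 => by
    rw [← rank_wronskian_eq_chart (hY t h1).1 h2 h3, rank_wronskian_comm, hr t h1]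
  have i1 := eventually_negIndex_eq ((tendsto_chart hYc hτ hN).sub (tendsto_chart hZc hτ hK))
    (by filter_upwards [eA, eB] with t h1 h2; rw [Matrix.transpose_sub, h1, h2])
    (by rw [Matrix.transpose_sub, hA, hB])
    (by filter_upwards [eT, eN, eK] with t h1 h2 h3
        rw [rAB t h1 h2 h3, rAB τ hτ hN hK])
  have i2 := eventually_negIndex_eq (tendsto_chart hZc hτ hK) eB hB
    (by filter_upwards [eT, eK] with t h1 h2
        rw [rank_chart h2, rank_chart hK, hq t h1, hq τ hτ])
  filter_upwards [eT, eN, eK, i1, i2] with t h1 h2 h3 h4 h5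
  rw [compIndex_add_negIndex_chart (hY t h1).1 (hZ t h1).1 h2 h3,
    compIndex_add_negIndex_chart (hY τ hτ).1 (hZ τ hτ).1 hN hK, h4, h5]

end Local

/-! ### Independence, duality and existence of admissible systems -/

namespace AdmissibleSystem

variable {n : ℕ} {a b : ℝ} {Y : ℝ → Matrix (Fin n ⊕ Fin n) (Fin n) ℝ}

theorem sum_succ_sub_castSucc {p : ℕ} (f : Fin (p + 1) → ℤ) :
    ∑ k : Fin p, (f k.succ - f k.castSucc) = f (Fin.last p) - f 0 := by
  have h1 := Fin.sum_univ_succ f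
  have h2 := Fin.sum_univ_castSucc f
  rw [Finset.sum_sub_distrib]
  linarith

theorem t_mem (S : AdmissibleSystem a b Y) (k : Fin (S.p + 1)) : S.t k ∈ Icc a b :=
  ⟨S.t_first.symm.trans_le (S.strictMono.monotone (Fin.zero_le k)),
    (S.strictMono.monotone (Fin.le_last k)).trans_eq S.t_last⟩

theorem t_castSucc_le (S : AdmissibleSystem a b Y) (k : Fin S.p) :
    S.t k.castSucc ≤ S.t k.succ :=
  (S.strictMono k.castSucc_lt_succ).le

/-- The projection of `s` to the `k`-th subinterval. -/
noncomputable def clamp (S : AdmissibleSystem a b Y) (k : Fin S.p) (s : ℝ) : ℝ :=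
  max (S.t k.castSucc) (min s (S.t k.succ))

theorem clamp_mem (S : AdmissibleSystem a b Y) (k : Fin S.p) (s : ℝ) :
    S.clamp k s ∈ Icc (S.t k.castSucc) (S.t k.succ) :=
  ⟨le_max_left _ _, max_le (S.t_castSucc_le k) (min_le_right _ _)⟩

theorem Icc_subset (S : AdmissibleSystem a b Y) (k : Fin S.p) :
    Icc (S.t k.castSucc) (S.t k.succ) ⊆ Icc a b :=
  Icc_subset_Icc (S.t_mem _).1 (S.t_mem _).2

theorem tendsto_clamp (S : AdmissibleSystem a b Y) (k : Fin S.p) (τ : ℝ) :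
    Filter.Tendsto (S.clamp k) (nhdsWithin τ (Icc a b))
      (nhdsWithin (S.clamp k τ) (Icc (S.t k.castSucc) (S.t k.succ))) := by
  refine tendsto_nhdsWithin_of_tendsto_nhds_of_eventually_within _ ?_
    (Filter.Eventually.of_forall fun s => S.clamp_mem k s)
  have : Continuous (S.clamp k) := by unfold clamp; fun_prop
  exact this.continuousWithinAt

/-- Each term is the increment of `g` from `min s (t k)` to `min s (t (k + 1))`, so the sum
telescopes. -/
theorem sum_clamp (S : AdmissibleSystem a b Y) (g : ℝ → ℤ) {s : ℝ} (hs : s ∈ Icc a b) :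
    ∑ k : Fin S.p, (g (S.clamp k s) - g (S.t k.castSucc)) = g s - g a := by
  have h : ∀ k : Fin S.p, g (S.clamp k s) - g (S.t k.castSucc) =
      g (min s (S.t k.succ)) - g (min s (S.t k.castSucc)) := by
    intro k
    have hk := S.t_castSucc_le k
    rcases le_total s (S.t k.castSucc) with h | h
    · rw [clamp, min_eq_left (h.trans hk), min_eq_left h, max_eq_left h]
      simp
    · rw [clamp, min_eq_right h, max_eq_right (le_min h hk)]
  rw [Finset.sum_congr rfl fun k _ => h k,
    sum_succ_sub_castSucc fun k => g (min s (S.t k)), S.t_last, S.t_first,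
    min_eq_left hs.2, min_eq_right hs.1]

/-- The partial sum of `S.osc` up to the time `s`. -/
noncomputable def oscUpTo (S : AdmissibleSystem a b Y) (s : ℝ) : ℤ :=
  ∑ k : Fin S.p,
    ((compIndex (Y (S.clamp k s)) (S.R k (S.clamp k s) * vert n) : ℤ)
      - (compIndex (Y (S.t k.castSucc)) (S.R k (S.t k.castSucc) * vert n) : ℤ))

theorem oscUpTo_left (S : AdmissibleSystem a b Y) : S.oscUpTo a = 0 := by
  refine Finset.sum_eq_zero fun k _ => ?_
  have : S.clamp k a = S.t k.castSucc :=
    max_eq_left ((min_le_left _ _).trans (S.t_mem _).1)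
  rw [this, sub_self]

theorem oscUpTo_right (S : AdmissibleSystem a b Y) : S.oscUpTo b = S.osc := by
  refine Finset.sum_congr rfl fun k _ => ?_
  have : S.clamp k b = S.t k.succ := by
    rw [clamp, min_eq_right (S.t_mem _).2, max_eq_right (S.t_castSucc_le k)]
  rw [this]

/-- The local result is applied at every clamped point, and the chart terms telescope. Only finitely
many `s` are excluded, so two systems can share a chart. -/
theorem exists_finite_eventually_oscUpTo_add_eq (hY : IsLagrangianPath a b Y)
    (S : AdmissibleSystem a b Y) {τ : ℝ} (hτ : τ ∈ Icc a b) :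
    ∃ F : Set ℝ, F.Finite ∧ ∀ s ∉ F, ∀ᶠ t in nhdsWithin τ (Icc a b),
      S.oscUpTo t + negIndex (chart s (Y t)) = S.oscUpTo τ + negIndex (chart s (Y τ)) := by
  have hZ : ∀ k, ∀ t ∈ Icc a b, IsLagrangianPlane (S.R k t * vert n) := fun k t ht =>
    isLagrangianPlane_mul_vert (S.symplectic k t ht)
  have hc : ∀ k, S.clamp k τ ∈ Icc a b := fun k => S.Icc_subset k (S.clamp_mem k τ)
  refine ⟨⋃ k, ({s | ¬IsUnit (chartDen s (Y (S.clamp k τ)))} ∪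
    {s | ¬IsUnit (chartDen s (S.R k (S.clamp k τ) * vert n))}), Set.finite_iUnion fun k =>
    (finite_not_isUnit_chartDen (hY.lagrangian _ (hc k))).union
      (finite_not_isUnit_chartDen (hZ k _ (hc k))), fun s hs => ?_⟩
  simp only [mem_iUnion, mem_union, Set.mem_ofPred_eq, not_exists, not_or, not_not] at hs
  have hk : ∀ k, ∀ᶠ t in nhdsWithin τ (Icc a b),
      compIndex (Y (S.clamp k t)) (S.R k (S.clamp k t) * vert n) +
        negIndex (chart s (Y (S.clamp k t))) =
      compIndex (Y (S.clamp k τ)) (S.R k (S.clamp k τ) * vert n) +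
        negIndex (chart s (Y (S.clamp k τ))) := by
    intro k
    obtain ⟨r, hr⟩ := S.rank_wronskian k
    obtain ⟨q, hq⟩ := S.rank_upper k
    have hR : ContinuousOn (fun t => S.R k t * vert n) (Icc (S.t k.castSucc) (S.t k.succ)) :=
      (continuous_id.matrix_mul continuous_const).comp_continuousOn (S.continuousOn k)
    exact (S.tendsto_clamp k τ).eventually (eventually_compIndex_add_eq
      (hY.continuousOn.mono (S.Icc_subset k)) hR
      (fun t ht => hY.lagrangian t (S.Icc_subset k ht))
      (fun t ht => hZ k t (S.Icc_subset k ht)) hr hq (S.clamp_mem k τ) (hs k).1 (hs k).2)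
  filter_upwards [Filter.eventually_all.2 hk, self_mem_nhdsWithin] with t ht htm
  have h1 := S.sum_clamp (fun t => (negIndex (chart s (Y t)) : ℤ)) htm
  have h2 := S.sum_clamp (fun t => (negIndex (chart s (Y t)) : ℤ)) hτ
  -- The planes at partition points may lie outside the chart; their terms are the same on both
  -- sides, so this is harmless.
  have h3 : S.oscUpTo t + ∑ k : Fin S.p, ((negIndex (chart s (Y (S.clamp k t))) : ℤ) -
        negIndex (chart s (Y (S.t k.castSucc)))) =
      S.oscUpTo τ + ∑ k : Fin S.p, ((negIndex (chart s (Y (S.clamp k τ))) : ℤ) -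
        negIndex (chart s (Y (S.t k.castSucc)))) := by
    rw [oscUpTo, oscUpTo, ← Finset.sum_add_distrib, ← Finset.sum_add_distrib]
    refine Finset.sum_congr rfl fun k _ => ?_
    have := ht k
    omega
  rw [h1, h2] at h3
  linarith

/-- The chart term cancels in the difference of partial sums, so the chart may vary with `τ`. The
integer-valued difference is continuous on an interval, hence constant. -/
theorem osc_eq (hab : a ≤ b) (hY : IsLagrangianPath a b Y) (S S' : AdmissibleSystem a b Y) :
    S.osc = S'.osc := by
  have hc : ContinuousOn (fun t => S.oscUpTo t - S'.oscUpTo t) (Icc a b) := by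
    intro τ hτ
    obtain ⟨F, hF, h⟩ := exists_finite_eventually_oscUpTo_add_eq hY S hτ
    obtain ⟨F', hF', h'⟩ := exists_finite_eventually_oscUpTo_add_eq hY S' hτ
    obtain ⟨s, hs⟩ := (hF.union hF').exists_notMem
    rw [mem_union, not_or] at hs
    refine tendsto_const_nhds.congr' ?_
    filter_upwards [h s hs.1, h' s hs.2] with t h1 h2
    linarith
  have := isPreconnected_Icc.constant hc (left_mem_Icc.2 hab) (right_mem_Icc.2 hab)
  simp only [oscUpTo_left, oscUpTo_right] at this
  linarith

theorem dualOsc_add_rank (hY : IsLagrangianPath a b Y) (S : AdmissibleSystem a b Y) :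
    S.osc + ((Y b).toRows₁.rank : ℤ) = S.dualOsc + ((Y a).toRows₁.rank : ℤ) := by
  have h := sum_succ_sub_castSucc fun k => ((Y (S.t k)).toRows₁.rank : ℤ)
  rw [S.t_last, S.t_first] at h
  have h2 : S.dualOsc = S.osc + ∑ k : Fin S.p,
      (((Y (S.t k.succ)).toRows₁.rank : ℤ) - ((Y (S.t k.castSucc)).toRows₁.rank : ℤ)) := by
    rw [dualOsc, osc, ← Finset.sum_add_distrib]
    refine Finset.sum_congr rfl fun k _ => ?_
    obtain ⟨r, hr⟩ := S.rank_wronskian k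
    obtain ⟨q, hq⟩ := S.rank_upper k
    have key : ∀ t ∈ Icc (S.t k.castSucc) (S.t k.succ),
        compIndex (Y t) (S.R k t * vert n) + dualCompIndex (Y t) (S.R k t * vert n) +
          (Y t).toRows₁.rank = r + q := fun t ht => by
      rw [compIndex_add_dualCompIndex (hY.lagrangian t (S.Icc_subset k ht))
        (isLagrangianPlane_mul_vert (S.symplectic k t (S.Icc_subset k ht))), hr t ht, hq t ht]
    have h1 := key _ (left_mem_Icc.2 (S.t_castSucc_le k))
    have h2 := key _ (right_mem_Icc.2 (S.t_castSucc_le k))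
    omega
  linarith

/-- On a short enough interval one `s` keeps `U - s X` invertible. The constant shear for that `s`
then has Wronskian `U - s X`, of rank `n`. -/
theorem nonempty_of_isLagrangianPath (hab : a ≤ b) (hY : IsLagrangianPath a b Y) :
    Nonempty (AdmissibleSystem a b Y) := by
  -- For `a = b` the partition has one point and no subinterval.
  rcases hab.eq_or_lt with rfl | hlt
  · exact ⟨⟨0, fun _ => a, fun i j hij => absurd hij (by simp [Subsingleton.elim (α := Fin 1) i j]), rfl, rfl, fun k => k.elim0,
      fun k => k.elim0, fun k => k.elim0, fun k => k.elim0, fun k => k.elim0⟩⟩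
  have hdet : ∀ s : ℝ, ∃ u : Set ℝ, IsOpen u ∧
      (fun t => (chartDen s (Y t)).det) ⁻¹' {0}ᶜ ∩ Icc a b = u ∩ Icc a b := fun s =>
    continuousOn_iff'.1 (continuous_id.matrix_det.comp_continuousOn
      (continuousOn_chartDen hY.continuousOn s)) _ isOpen_compl_singleton
  choose u huo hu using hdet
  obtain ⟨δ, hδ, hball⟩ := lebesgue_number_lemma_of_metric isCompact_Icc huo
    (show Icc a b ⊆ ⋃ s, u s from fun t ht => by
      obtain ⟨s, hs⟩ := (finite_not_isUnit_chartDen (hY.lagrangian t ht)).exists_notMem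
      simp only [Set.mem_ofPred_eq, not_not] at hs
      have : t ∈ u s ∩ Icc a b := by
        rw [← hu s]
        exact ⟨((Matrix.isUnit_iff_isUnit_det _).1 hs).ne_zero, ht⟩
      exact mem_iUnion.2 ⟨s, this.1⟩)
  obtain ⟨N, hN⟩ := exists_nat_gt ((b - a) / δ)
  have hba : 0 < b - a := sub_pos.2 hlt
  have hN0 : (0 : ℝ) < N := lt_trans (by positivity) hN
  -- The mesh is below the Lebesgue number `δ`, so each closed subinterval lies in the `δ`-ball
  -- about its left endpoint.
  set h := (b - a) / N with hh
  have hpos : 0 < h := by positivity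
  have hhδ : h < δ := by
    rw [div_lt_iff₀ hδ] at hN
    rw [hh, div_lt_iff₀ hN0]
    linarith
  have hNh : N * h = b - a := by rw [hh]; field_simp
  have hs : ∀ k : Fin N, ∃ s : ℝ, ∀ t ∈ Icc (a + k * h) (a + (k + 1 : ℕ) * h),
      IsUnit (chartDen s (Y t)) := by
    intro k
    have hk : ((k : ℕ) + 1 : ℝ) ≤ N := by exact_mod_cast k.2
    have hk1 : ((k : ℕ) + 1 : ℝ) * h ≤ b - a := by
      rw [← hNh]; exact mul_le_mul_of_nonneg_right hk hpos.le
    have hk0 : 0 ≤ (k : ℕ) * h := by positivity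
    obtain ⟨s, hs⟩ := hball (a + k * h) ⟨by linarith, by linarith⟩
    refine ⟨s, fun t ht => ?_⟩
    have ht2 := ht.2
    push_cast at ht2
    have : t ∈ u s ∩ Icc a b := by
      refine ⟨hs ?_, by linarith [ht.1], by linarith⟩
      rw [Metric.mem_ball, Real.dist_eq, abs_of_nonneg (by linarith [ht.1])]
      linarith
    rw [← hu s] at this
    exact (Matrix.isUnit_iff_isUnit_det _).2 (isUnit_iff_ne_zero.2 this.1)
  choose s hs using hs
  refine ⟨⟨N, fun k => a + k * h, fun i j hij => ?_, by simp, by simp [hNh],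
    fun k _ => shear n (s k), fun k t _ => isSymplectic_shear _, fun k => continuousOn_const,
    fun k => ⟨n, fun t ht => ?_⟩, fun k => ⟨_, fun t _ => rfl⟩⟩⟩
  · have : ((i : ℕ) : ℝ) < (j : ℕ) := by exact_mod_cast hij
    have := mul_lt_mul_of_pos_right this hpos
    simpa using this
  · rw [wronskian_shear, Matrix.rank_of_isUnit _ (hs k t (by simpa using ht)), Fintype.card_fin]

end AdmissibleSystem

end LagrangianPath

theorem theoremT (n : ℕ) (a b : ℝ) (hab : a ≤ b)
    (Y : ℝ → Matrix (Fin n ⊕ Fin n) (Fin n) ℝ)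
    (hY : LagrangianPath.IsLagrangianPath a b Y) :
    Nonempty (LagrangianPath.AdmissibleSystem a b Y) ∧
    (∀ S : LagrangianPath.AdmissibleSystem a b Y, S.osc = LagrangianPath.oscNumber a b Y) ∧
    (∀ S : LagrangianPath.AdmissibleSystem a b Y,
      S.dualOsc = LagrangianPath.dualOscNumber a b Y) ∧
    LagrangianPath.oscNumber a b Y + ((Y b).toRows₁.rank : ℤ)
      = LagrangianPath.dualOscNumber a b Y + ((Y a).toRows₁.rank : ℤ) := by
  have hne := LagrangianPath.AdmissibleSystem.nonempty_of_isLagrangianPath hab hY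
  have hosc : ∀ S : LagrangianPath.AdmissibleSystem a b Y,
      S.osc = LagrangianPath.oscNumber a b Y := fun S => by
    rw [LagrangianPath.oscNumber, dif_pos hne]
    exact S.osc_eq hab hY _
  have hdual : ∀ S : LagrangianPath.AdmissibleSystem a b Y,
      S.dualOsc = LagrangianPath.dualOscNumber a b Y := fun S => by
    rw [LagrangianPath.dualOscNumber, dif_pos hne]
    have h1 := S.dualOsc_add_rank hY
    have h2 := (Classical.choice hne).dualOsc_add_rank hY
    have h3 := S.osc_eq hab hY (Classical.choice hne)
    linarith
  refine ⟨hne, hosc, hdual, ?_⟩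
  obtain ⟨S⟩ := hne
  rw [← hosc S, ← hdual S]
  exact S.dualOsc_add_rank hY
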